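/- Let $n\ge 0$. A generalized non-crossing tree (GNC-tree) on $n+1$ points is a tree whose vertices are $n+1$ points $0,1,\dots,n$ placed in counterclockwise order on a circle, whose edges, drawn as chords, do not cross, together with positive integer labels of the points that are weakly increasing in the order $0,1,\dots,n$ and such that if $j\ge 1$ is a label then every $1\le i\le j$ is a label. The tree is rooted at the first point $0$ (which has label $1$). An edge, directed away from the root, from a vertex labelled $a$ to a vertex labelled $b$ is an ascent ($u$) if $a<b$, a level ($h$) if $a=b$, and a descent ($d$) if $a>b$; every path starting at the root is thus encoded by a word on $\{u,h,d\}$. The tree is called alternating if it is $\{uu,dd,h\}$-avoiding, i.e. if none of these words contains $uu$, $dd$ or $h$ as a block of consecutive letters. Let $C_i=\frac1{i+1}\binom{2i}{i}$ be the Catalan numbers and $C(t)=\sum_{i\ge0}C_it^i$. Put $\binom{m}{l}=0$ if $l<0$ or $l>m$. For every $n\ge 0$, the number $a_n$ of alternating GNC-trees on $n+1$ points is $$a_n=\sum_{i=0}^{n}(-1)^{n-i}\binom{i+1}{n-i}2^iC_i,$$ and, as formal power series, $\sum_{n\ge0}a_nt^n=(1-t)\,C\bigl(2t(1-t)\bigr)$.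 Moreover, for all $n,r\ge 0$, the number of alternating GNC-trees on $n+1$ points with exactly $r$ ascents is $$\sum_{\substack{i,j,k\ge 0\\ i+j+k=n}}(-1)^{r+k}\binom{i+1}{j}\binom{2i+k}{k}\binom{k}{r-j}2^{i+k}C_i .$$ -/

import Mathlib

/-- The three kinds of edges, seen from the root: `u` is an ascent, `h` a level,
`d` a descent. -/
inductive EdgeStep where
  | u : EdgeStep
  | h : EdgeStep
  | d : EdgeStep

/-- The kind of an edge that leads from a vertex labelled `a` to one labelled `b`. -/
def EdgeStep.ofLabels (a b : ℕ) : EdgeStep :=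
  if a < b then EdgeStep.u else if a = b then EdgeStep.h else EdgeStep.d

/-- A graph on the points `0, 1, …, n`, placed in this (counterclockwise) order on a circle
and with edges drawn as chords, is non-crossing if no two chords cross in the interior, i.e.
if no two edges have alternating end points. -/
def SimpleGraph.NonCrossing {n : ℕ} (G : SimpleGraph (Fin (n + 1))) : Prop :=
  ∀ a b c d : Fin (n + 1), a < b → b < c → c < d → ¬ (G.Adj a c ∧ G.Adj b d)

/-- A rooted generalized non-crossing tree on `n + 1` points: a non-crossing tree on `n + 1`
points of a circle, with positive integer labels that are weakly increasing in
counterclockwise order and such that every `1 ≤ i ≤ j` is a label whenever `j` is one.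
The root is the first point (the first one with label `1`), here `0`. -/
@[ext]
structure GNCTree (n : ℕ) where
  graph : SimpleGraph (Fin (n + 1))
  isTree : graph.IsTree
  nonCrossing : graph.NonCrossing
  label : Fin (n + 1) → ℕ
  label_pos : ∀ v, 1 ≤ label v
  label_mono : Monotone label
  label_initial : ∀ v i, 1 ≤ i → i ≤ label v → ∃ w, label w = i

namespace GNCTree

theorem label_le {n : ℕ} (T : GNCTree n) (v : Fin (n + 1)) : T.label v ≤ n + 1 := by
  have h : Finset.Icc 1 (T.label v) ⊆ Finset.univ.image T.label := by
    intro i hi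
    obtain ⟨h1, h2⟩ := Finset.mem_Icc.1 hi
    obtain ⟨w, hw⟩ := T.label_initial v i h1 h2
    exact Finset.mem_image.2 ⟨w, Finset.mem_univ _, hw⟩
  have h3 := (Finset.card_le_card h).trans Finset.card_image_le
  simpa using h3

/-- There are only finitely many such trees, so that the cardinalities below are honest. -/
instance instFinite (n : ℕ) : Finite (GNCTree n) := by
  refine Finite.of_injective
    (fun T : GNCTree n =>
      ((T.graph, fun v => ⟨T.label v, Nat.lt_succ_of_le (T.label_le v)⟩) :
        SimpleGraph (Fin (n + 1)) × (Fin (n + 1) → Fin (n + 2)))) ?_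
  intro S T hST
  obtain ⟨h1, h2⟩ := Prod.mk.inj hST
  refine GNCTree.ext h1 (funext fun v => ?_)
  exact congrArg Fin.val (congrFun h2 v)

variable {n : ℕ} (T : GNCTree n)

/-- The word on `{u, h, d}` that encodes a walk. -/
def word {a b : Fin (n + 1)} (p : T.graph.Walk a b) : List EdgeStep :=
  p.darts.map fun e => EdgeStep.ofLabels (T.label e.fst) (T.label e.snd)

/-- `T` avoids the pattern `σ`: no path that starts at the root has a block of consecutive
edges encoded by `σ`. -/
def Avoids (σ : List EdgeStep) : Prop :=
  ∀ (v : Fin (n + 1)) (p : T.graph.Walk 0 v), p.IsPath → ¬ σ <:+: T.word p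

/-- The ascents of `T`: the edges `(i, j)`, with `i` on the path from the root to `j`, such
that the label of `i` is smaller than the label of `j`. -/
def ascents : Set (Fin (n + 1) × Fin (n + 1)) :=
  {e | T.graph.Adj e.1 e.2 ∧ (∃ p : T.graph.Walk 0 e.2, p.IsPath ∧ e.1 ∈ p.support) ∧
    T.label e.1 < T.label e.2}

/-- `T` is alternating: it avoids `uu`, `dd` and `h`. -/
def IsAlternating : Prop :=
  T.Avoids [EdgeStep.u, EdgeStep.u] ∧ T.Avoids [EdgeStep.d, EdgeStep.d] ∧
    T.Avoids [EdgeStep.h]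

end GNCTree

/-! Labels increase weakly around the circle, so once `h` is avoided every chord is strictly
increasing in its labels from the smaller to the larger point. Avoiding `uu` and `dd` then says that
no point has both a smaller and a larger neighbour.

A non-crossing tree of this shape contains the chord joining its two extreme points; deleting it
leaves two such trees on consecutive intervals. This gives a binary tree with one node per chord
(`exists_edges`). Each node also corresponds to the gap between neighbouring points where its chord
splits the interval. Since consecutive labels differ by 0 or 1 and the first label is 1, a labelling
is a Boolean on each gap. A chord is strict iff some gap below it is a jump; it suffices to ask this
of childless nodes, as every non-empty subtree contains one (`leavesTrue_iff`).

A point is entered by an ascent iff it is the larger end of some chord, so ascents become upper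
ends, which are counted recursively along the binary tree. With `q` marking them, the generating
function satisfies F = 1 + t(2F(F + q - 1) - q). This quadratic has a unique power series solution,
expressible through the Catalan series (`mk_totalWeight_eq_closedForm`). Expanding it and extracting
coefficients gives the refined formula; `q = 1` gives the total count. -/

namespace BinaryTree

/-! ### Chord systems encoded by binary trees -/

/-- The chords of the non-crossing tree on `s, s + 1, …, s + t.numNodes` encoded by `t`: the root
is the chord that joins the two extreme points, and removing it leaves the trees encoded by the
two subtrees, on two consecutive intervals. -/
def edges {α : Type*} : BinaryTree α → ℕ → Finset (ℕ × ℕ)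
  | nil, _ => ∅
  | node _ l r, s =>
      insert (s, s + l.numNodes + r.numNodes + 1)
        (l.edges s ∪ r.edges (s + l.numNodes + 1))

/-- The values of `t`, read in infix order and indexed by `s, s + 1, …`. -/
def gap : BinaryTree Bool → ℕ → ℕ → Bool
  | nil, _, _ => false
  | node v l r, s, x =>
      if x < s + l.numNodes then l.gap s x
      else if x = s + l.numNodes then v else r.gap (s + l.numNodes + 1) x

/-- All nodes without children carry the value `true`. -/
def LeavesTrue : BinaryTree Bool → Prop
  | nil => True
  | node v l r => (l = nil → r = nil → v = true) ∧ l.LeavesTrue ∧ r.LeavesTrue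

/-- The number of points that are the larger end of some chord of `t.edges s`. -/
def numUpper {α : Type*} : BinaryTree α → ℕ
  | nil => 0
  | node _ l nil => l.numUpper + 1
  | node _ l (node v a b) => l.numUpper + (node v a b).numUpper

theorem mem_edges_node {α : Type*} {v : α} {l r : BinaryTree α} {s a b : ℕ} :
    (a, b) ∈ (node v l r).edges s ↔
      (a = s ∧ b = s + l.numNodes + r.numNodes + 1) ∨ (a, b) ∈ l.edges s ∨
        (a, b) ∈ r.edges (s + l.numNodes + 1) := by
  simp [edges]

theorem not_mem_edges_nil {α : Type*} {s : ℕ} {p : ℕ × ℕ} :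
    p ∉ (nil : BinaryTree α).edges s := by
  simp [edges]

theorem bounds_of_mem_edges {α : Type*} {t : BinaryTree α} {s a b : ℕ} (h : (a, b) ∈ t.edges s) :
    s ≤ a ∧ a < b ∧ b ≤ s + t.numNodes := by
  induction t generalizing s with
  | nil => exact absurd h not_mem_edges_nil
  | node v l r hl hr =>
    rw [numNodes]
    rcases mem_edges_node.1 h with h | h | h
    · omega
    · have := hl h; omega
    · have := hr h; omega

theorem mem_edges_root {α : Type*} {t : BinaryTree α} (ht : t ≠ nil) (s : ℕ) :
    (s, s + t.numNodes) ∈ t.edges s := by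
  cases t with
  | nil => exact absurd rfl ht
  | node v l r => exact mem_edges_node.2 (Or.inl ⟨rfl, by rw [numNodes]; omega⟩)

/-- Only this inequality is needed: connectedness supplies the reverse bound when the graph is shown
to be a tree. -/
theorem card_edges_le {α : Type*} (t : BinaryTree α) (s : ℕ) :
    (t.edges s).card ≤ t.numNodes := by
  induction t generalizing s with
  | nil => simp [edges]
  | node v l r hl hr =>
    rw [edges, numNodes]
    refine (Finset.card_insert_le _ _).trans ?_
    have h1 := Finset.card_union_le (l.edges s) (r.edges (s + l.numNodes + 1))
    have h2 := hl s
    have h3 := hr (s + l.numNodes + 1)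
    omega

/-- The two subtrees live on disjoint intervals, and the root chord ends at the extreme points,
where no chord can continue in the same direction. -/
theorem edges_alternating {α : Type*} {t : BinaryTree α} {s a b c : ℕ} (h1 : (a, b) ∈ t.edges s)
    (h2 : (b, c) ∈ t.edges s) : False := by
  induction t generalizing s with
  | nil => exact not_mem_edges_nil h1
  | node v l r hl hr =>
    have b1 := bounds_of_mem_edges h1
    have b2 := bounds_of_mem_edges h2
    rw [numNodes] at b1 b2
    rcases mem_edges_node.1 h1 with h1 | h1 | h1 <;>
      rcases mem_edges_node.1 h2 with h2 | h2 | h2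
    · omega
    · omega
    · omega
    · omega
    · exact hl h1 h2
    · have := bounds_of_mem_edges h1; have := bounds_of_mem_edges h2; omega
    · omega
    · have := bounds_of_mem_edges h1; have := bounds_of_mem_edges h2; omega
    · exact hr h1 h2

theorem edges_nonCrossing {α : Type*} {t : BinaryTree α} {s a b c d : ℕ}
    (h1 : (a, c) ∈ t.edges s) (h2 : (b, d) ∈ t.edges s) (hab : a < b) (hbc : b < c)
    (hcd : c < d) : False := by
  induction t generalizing s with
  | nil => exact not_mem_edges_nil h1
  | node v l r hl hr =>
    have b1 := bounds_of_mem_edges h1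
    have b2 := bounds_of_mem_edges h2
    rw [numNodes] at b1 b2
    rcases mem_edges_node.1 h1 with h1 | h1 | h1 <;>
      rcases mem_edges_node.1 h2 with h2 | h2 | h2
    · omega
    · omega
    · omega
    · omega
    · exact hl h1 h2
    · have := bounds_of_mem_edges h1; have := bounds_of_mem_edges h2; omega
    · omega
    · have := bounds_of_mem_edges h1; have := bounds_of_mem_edges h2; omega
    · exact hr h1 h2

end BinaryTree

/-! ### Connected alternating non-crossing relations are binary trees -/

/-- The relation `R` connects the integer interval from `s` to `e`: no proper non-empty part of
the interval is closed under `R`. -/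
def ConnectsInterval (R : ℕ → ℕ → Prop) (s e : ℕ) : Prop :=
  ∀ S : Set ℕ, (∃ x ∈ S, s ≤ x ∧ x ≤ e) →
    (∀ a b, R a b → s ≤ a → b ≤ e → (a ∈ S ↔ b ∈ S)) → ∀ x, s ≤ x → x ≤ e → x ∈ S

namespace BinaryTree

theorem connectsInterval_edges {α : Type*} (t : BinaryTree α) (s : ℕ) :
    ConnectsInterval (fun a b => (a, b) ∈ t.edges s) s (s + t.numNodes) := by
  induction t generalizing s with
  | nil =>
    rintro S ⟨x, hx, h1, h2⟩ - y h3 h4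
    simp only [numNodes] at h2 h4
    rwa [show y = x by omega]
  | node v l r hl hr =>
    rintro S ⟨x, hx, h1, h2⟩ hS y h3 h4
    have hroot := hS _ _ (mem_edges_root (t := node v l r) (by simp) s) le_rfl le_rfl
    rw [numNodes] at *
    have hl' := fun hne => hl s S hne fun a b hab ha hb =>
      hS a b (mem_edges_node.2 (Or.inr (Or.inl hab))) ha (by omega)
    have hr' := fun hne => hr (s + l.numNodes + 1) S hne fun a b hab ha hb =>
      hS a b (mem_edges_node.2 (Or.inr (Or.inr hab))) (by omega) (by omega)
    have key : s ∈ S := by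
      by_cases hxl : x ≤ s + l.numNodes
      · exact hl' ⟨x, hx, h1, hxl⟩ s le_rfl (by omega)
      · exact hroot.2 (hr' ⟨x, hx, by omega, by omega⟩ _ (by omega) (by omega))
    by_cases hy : y ≤ s + l.numNodes
    · exact hl' ⟨s, key, by omega, by omega⟩ y h3 hy
    · exact hr' ⟨_, hroot.1 key, by omega, by omega⟩ y (by omega) (by omega)

/-- A non-crossing alternating relation that connects an interval is encoded by a binary tree. -/
theorem exists_edges {R : ℕ → ℕ → Prop} (hlt : ∀ a b, R a b → a < b)
    (hnc : ∀ a b c d, a < b → b < c → c < d → R a c → ¬ R b d)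
    (halt : ∀ a b c, R a b → ¬ R b c) (g : ℕ → Bool) (n : ℕ) :
    ∀ s, ConnectsInterval R s (s + n) → ∃ t : BinaryTree Bool, t.numNodes = n ∧
      (∀ a b, s ≤ a → b ≤ s + n → (R a b ↔ (a, b) ∈ t.edges s)) ∧
      ∀ x, s ≤ x → x < s + n → t.gap s x = g x := by
  classical
  induction n using Nat.strong_induction_on with
  | _ n ih =>
  intro s hc
  rcases Nat.eq_zero_or_pos n with rfl | hn
  · refine ⟨nil, rfl, fun a b ha hb => ⟨fun h => ?_, fun h => absurd h not_mem_edges_nil⟩,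
      fun x h1 h2 => ?_⟩
    · have := hlt a b h; omega
    · omega
  set e := s + n with he
  -- the extreme points are joined
  have hse : R s e := by
    -- Let `b` be the largest neighbour of `s`. If `b < e`, no chord leaves the interval from `s` to
    -- `b`: from `s` it would contradict maximality, from `b` alternation, and from in between it
    -- would cross the chord from `s` to `b`.
    let b := Nat.findGreatest (R s) e
    have hbe : b ≤ e := Nat.findGreatest_le e
    have hmax : ∀ y, R s y → y ≤ e → y ≤ b := fun y hy hye => Nat.le_findGreatest hye hy
    have hb : R s b := by
      by_contra hb
      have hno : ∀ y, y ≤ e → ¬ R s y := fun y hye hy => hb (Nat.findGreatest_spec hye hy)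
      have := hc {s} ⟨s, rfl, le_rfl, by omega⟩ (fun x y hxy hx hy => by
        have hxy' := hlt x y hxy
        simp only [Set.mem_singleton_iff]
        constructor
        · rintro rfl; exact absurd hxy (hno y hy)
        · rintro rfl; omega) e (by omega) le_rfl
      simp only [Set.mem_singleton_iff] at this
      omega
    have hsb := hlt s b hb
    rcases hbe.eq_or_lt with hbe | hbe
    · rwa [hbe] at hb
    exfalso
    have := hc (Set.Iic b) ⟨b, Set.mem_Iic.2 le_rfl, hsb.le, hbe.le⟩ (fun x y hxy hx hy => by
      have hxy' := hlt x y hxy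
      simp only [Set.mem_Iic]
      refine ⟨fun h => ?_, fun h => by omega⟩
      by_contra hyb
      rcases hx.eq_or_lt with rfl | hx
      · exact hyb (hmax y hxy hy)
      rcases h.eq_or_lt with rfl | h
      · exact halt s _ y hb hxy
      · exact hnc s x b y hx h (by omega) hb hxy) e (by omega) le_rfl
    simp only [Set.mem_Iic] at this
    omega
  -- the other neighbours of the extreme points
  let k := Nat.findGreatest (fun y => y = s ∨ R s y) (e - 1)
  have hke : k ≤ e - 1 := Nat.findGreatest_le _
  -- The default `k = s` occurs when `s` has no neighbour other than `e`; the left part is then a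
  -- single point. Dually, `m` may equal `e`.
  have hk : k = s ∨ R s k :=
    Nat.findGreatest_spec (P := fun y => y = s ∨ R s y) (m := s) (by omega) (Or.inl rfl)
  have hkmax : ∀ y, R s y → y < e → y ≤ k := fun y hy hye =>
    Nat.le_findGreatest (P := fun y => y = s ∨ R s y) (by omega) (Or.inr hy)
  have hsk : s ≤ k := by
    rcases hk with h | h
    · omega
    · exact (hlt _ _ h).le
  have hex : ∃ y, s < y ∧ (y = e ∨ R y e) := ⟨e, by omega, Or.inl rfl⟩
  let m := Nat.find hex
  obtain ⟨hsm, hm⟩ : s < m ∧ (m = e ∨ R m e) := Nat.find_spec hex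
  have hmmin : ∀ y, s < y → R y e → m ≤ y := fun y hy hye => Nat.find_min' hex ⟨hy, Or.inr hye⟩
  have hme : m ≤ e := Nat.find_min' hex ⟨by omega, Or.inl rfl⟩
  -- Otherwise the chords from `s` to `k` and from `m` to `e` cross, or meet at `k = m` against
  -- alternation.
  have hkm : k < m := by
    by_contra! h
    have h1 : R s k := by
      rcases hk with h' | h'
      · omega
      · exact h'
    have h2 : R m e := by
      rcases hm with h' | h'
      · omega
      · exact h'
    rcases h.eq_or_lt with h' | h'
    · exact halt s k e h1 (h' ▸ h2)
    · exact hnc s m k e hsm h' (by omega) h1 h2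
  -- no chord leaves the points strictly between `k` and `m`
  have hmk : m = k + 1 := by
    by_contra hne
    have := hc {y | k < y ∧ y < m} ⟨k + 1, ⟨by omega, by omega⟩, by omega, by omega⟩
      (fun x y hxy hx hy => by
        have hxy' := hlt x y hxy
        simp only [Set.mem_ofPred_eq]
        constructor
        · rintro ⟨h1, h2⟩
          refine ⟨by omega, ?_⟩
          by_contra! h3
          rcases hy.eq_or_lt with rfl | hy
          · have := hmmin x (by omega) hxy; omega
          have h4 : R m e := by
            rcases hm with h' | h'
            · omega
            · exact h'
          rcases h3.eq_or_lt with h3 | h3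
          · exact halt x y e hxy (h3 ▸ h4)
          · exact hnc x m y e h2 h3 hy hxy h4
        · rintro ⟨h1, h2⟩
          refine ⟨?_, by omega⟩
          by_contra! h3
          rcases hx.eq_or_lt with rfl | hx
          · have := hkmax y hxy (by omega); omega
          have h4 : R s k := by
            rcases hk with h' | h'
            · omega
            · exact h'
          rcases h3.eq_or_lt with h3 | h3
          · exact halt s k y h4 (h3 ▸ hxy)
          · exact hnc s x k y hx h3 h1 h4 hxy) s le_rfl (by omega)
    simp only [Set.mem_ofPred_eq] at this
    omega
  -- The extreme chord is the only one over the cut between `k` and `k + 1`, so cutting there splits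
  -- the relation in two.
  have hcross : ∀ x y, R x y → s ≤ x → x ≤ k → k < y → y ≤ e → x = s ∧ y = e := by
    intro x y hxy h1 h2 h3 h4
    rcases h1.eq_or_lt with rfl | h1
    · refine ⟨rfl, ?_⟩
      by_contra hy
      have := hkmax y hxy (by omega)
      omega
    · exfalso
      have h5 : R s k := by
        rcases hk with h' | h'
        · omega
        · exact h'
      rcases h2.eq_or_lt with rfl | h2
      · exact halt s _ y h5 hxy
      · exact hnc s x k y h1 h2 h3 h5 hxy
  -- A closed set on the left part extends to the whole interval: add everything right of `k` if it
  -- contains `s`, nothing otherwise. Either way the extreme chord is respected. The right part is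
  -- symmetric, with `e` in the role of `s`.
  have hcl : ConnectsInterval R s (s + (k - s)) := by
    rintro S ⟨x, hx, h1, h2⟩ hS y h3 h4
    by_cases hs : s ∈ S
    · have := hc (S ∪ Set.Ioi k) ⟨x, Or.inl hx, h1, by omega⟩ (fun a b hab ha hb => by
        have hab' := hlt a b hab
        simp only [Set.mem_union, Set.mem_Ioi]
        by_cases hbk : b ≤ k
        · have := hS a b hab ha (by omega)
          constructor
          · rintro (h | h)
            · exact Or.inl (this.1 h)
            · omega
          · rintro (h | h)
            · exact Or.inl (this.2 h)
            · omega
        · by_cases hak : a ≤ k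
          · obtain ⟨rfl, rfl⟩ := hcross a b hab ha hak (by omega) hb
            exact ⟨fun _ => Or.inr (by omega), fun _ => Or.inl hs⟩
          · exact ⟨fun _ => Or.inr (by omega), fun _ => Or.inr (by omega)⟩) y h3 (by omega)
      rcases this with h | h
      · exact h
      · rw [Set.mem_Ioi] at h; omega
    · exfalso
      have := hc (S ∩ Set.Iic k) ⟨x, ⟨hx, Set.mem_Iic.2 (by omega)⟩, h1, by omega⟩
        (fun a b hab ha hb => by
          have hab' := hlt a b hab
          simp only [Set.mem_inter_iff, Set.mem_Iic]
          by_cases hbk : b ≤ k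
          · have := hS a b hab ha (by omega)
            rw [this]
            exact ⟨fun h => ⟨h.1, hbk⟩, fun h => ⟨h.1, by omega⟩⟩
          · refine ⟨fun h => ?_, fun h => by omega⟩
            obtain ⟨rfl, rfl⟩ := hcross a b hab ha h.2 (by omega) hb
            exact absurd h.1 hs) s le_rfl (by omega)
      exact hs this.1
  have hcr : ConnectsInterval R (k + 1) (k + 1 + (e - (k + 1))) := by
    rintro S ⟨x, hx, h1, h2⟩ hS y h3 h4
    by_cases hs : e ∈ S
    · have := hc (S ∪ Set.Iic k) ⟨x, Or.inl hx, by omega, by omega⟩ (fun a b hab ha hb => by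
        have hab' := hlt a b hab
        simp only [Set.mem_union, Set.mem_Iic]
        by_cases hbk : b ≤ k
        · exact ⟨fun _ => Or.inr (by omega), fun _ => Or.inr (by omega)⟩
        · by_cases hak : a ≤ k
          · obtain ⟨rfl, rfl⟩ := hcross a b hab ha hak (by omega) hb
            exact ⟨fun _ => Or.inl hs, fun _ => Or.inr (by omega)⟩
          · have := hS a b hab (by omega) (by omega)
            constructor
            · rintro (h | h)
              · exact Or.inl (this.1 h)
              · omega
            · rintro (h | h)
              · exact Or.inl (this.2 h)
              · omega) y (by omega) (by omega)
      rcases this with h | h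
      · exact h
      · rw [Set.mem_Iic] at h; omega
    · exfalso
      have := hc (S ∩ Set.Ioi k) ⟨x, ⟨hx, Set.mem_Ioi.2 (by omega)⟩, by omega, by omega⟩
        (fun a b hab ha hb => by
          have hab' := hlt a b hab
          simp only [Set.mem_inter_iff, Set.mem_Ioi]
          by_cases hak : k < a
          · have := hS a b hab (by omega) (by omega)
            rw [this]
            exact ⟨fun h => ⟨h.1, by omega⟩, fun h => ⟨h.1, by omega⟩⟩
          · refine ⟨fun h => by omega, fun h => ?_⟩
            obtain ⟨rfl, rfl⟩ := hcross a b hab ha (by omega) h.2 hb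
            exact absurd h.1 hs) e (by omega) (by omega)
      exact hs this.1
  obtain ⟨l, hl, hle, hlg⟩ := ih (k - s) (by omega) s hcl
  obtain ⟨r, hr, hre, hrg⟩ := ih (e - (k + 1)) (by omega) (k + 1) hcr
  have hslk : s + l.numNodes = k := by omega
  refine ⟨node (g k) l r, by rw [numNodes]; omega, fun a b ha hb => ?_, fun x h1 h2 => ?_⟩
  · rw [mem_edges_node, hslk]
    constructor
    · intro hab
      have hab' := hlt a b hab
      by_cases hbk : b ≤ k
      · exact Or.inr (Or.inl ((hle a b ha (by omega)).1 hab))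
      by_cases hak : a ≤ k
      · obtain ⟨rfl, rfl⟩ := hcross a b hab ha hak (by omega) hb
        exact Or.inl ⟨rfl, by omega⟩
      · exact Or.inr (Or.inr ((hre a b (by omega) (by omega)).1 hab))
    · rintro (⟨rfl, rfl⟩ | h | h)
      · rwa [show k + r.numNodes + 1 = e by omega]
      · have := bounds_of_mem_edges h
        exact (hle a b ha (by omega)).2 h
      · have := bounds_of_mem_edges h
        exact (hre a b (by omega) (by omega)).2 h
  · rw [gap, hslk]
    split_ifs with h3 h4
    · exact hlg x h1 (by omega)
    · rw [h4]
    · exact hrg x (by omega) (by omega)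

/-- A binary tree is determined by its chords and its values. -/
theorem eq_of_edges_eq_of_gap_eq {t t' : BinaryTree Bool} {s : ℕ}
    (hn : t.numNodes = t'.numNodes) (he : ∀ a b, (a, b) ∈ t.edges s ↔ (a, b) ∈ t'.edges s)
    (hg : ∀ x, s ≤ x → x < s + t.numNodes → t.gap s x = t'.gap s x) : t = t' := by
  induction t generalizing s t' with
  | nil =>
    cases t' with
    | nil => rfl
    | node v l r => simp at hn
  | node v l r hl hr =>
    cases t' with
    | nil => simp at hn
    | node v' l' r' =>
      simp only [numNodes] at hn hg
      -- If `l'` were larger than `l`, its root chord would start at `s` and be too long for `l` yet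
      -- too short to be the root chord of the whole tree.
      have aux : ∀ {v v' : Bool} {l r l' r' : BinaryTree Bool},
          l.numNodes + r.numNodes + 1 = l'.numNodes + r'.numNodes + 1 →
          (∀ a b, (a, b) ∈ (node v l r).edges s ↔ (a, b) ∈ (node v' l' r').edges s) →
          ¬ l.numNodes < l'.numNodes := by
        intro v v' l r l' r' hn he hlt
        have h1 : l' ≠ nil := by
          rintro rfl
          simp at hlt
        have h2 := (he _ _).2 (mem_edges_node.2 (Or.inr (Or.inl (mem_edges_root h1 s))))
        rcases mem_edges_node.1 h2 with h | h | h
        · omega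
        · have := bounds_of_mem_edges h; omega
        · have := bounds_of_mem_edges h; omega
      have h1 := aux hn he
      have h2 := aux hn.symm fun a b => (he a b).symm
      have hll : l.numNodes = l'.numNodes := by omega
      have hrr : r.numNodes = r'.numNodes := by omega
      have hv : v = v' := by
        have := hg (s + l.numNodes) (by omega) (by omega)
        simpa [gap, hll] using this
      have e1 : l = l' := by
        refine hl (s := s) hll (fun a b => ?_) fun x h3 h4 => ?_
        · have := he a b
          simp only [mem_edges_node] at this
          constructor
          · intro h
            have hb := bounds_of_mem_edges h
            rcases this.1 (Or.inr (Or.inl h)) with h | h | h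
            · omega
            · exact h
            · have := bounds_of_mem_edges h; omega
          · intro h
            have hb := bounds_of_mem_edges h
            rcases this.2 (Or.inr (Or.inl h)) with h | h | h
            · omega
            · exact h
            · have := bounds_of_mem_edges h; omega
        · have := hg x h3 (by omega)
          rwa [gap, gap, if_pos h4, if_pos (by omega)] at this
      have e2 : r = r' := by
        refine hr (s := s + l.numNodes + 1) hrr (fun a b => ?_) fun x h3 h4 => ?_
        · have := he a b
          simp only [mem_edges_node, ← hll] at this
          constructor
          · intro h
            have hb := bounds_of_mem_edges h
            rcases this.1 (Or.inr (Or.inr h)) with h | h | h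
            · omega
            · have := bounds_of_mem_edges h; omega
            · exact h
          · intro h
            have hb := bounds_of_mem_edges h
            rcases this.2 (Or.inr (Or.inr h)) with h | h | h
            · omega
            · have := bounds_of_mem_edges h; omega
            · exact h
        · have := hg x (by omega) (by omega)
          rwa [gap, gap, if_neg (by omega), if_neg (by omega), if_neg (by omega),
            if_neg (by omega), ← hll] at this
      rw [hv, e1, e2]

/-! ### Strictness of chords and upper ends -/

theorem LeavesTrue.exists_gap {t : BinaryTree Bool} (ht : t.LeavesTrue) (hne : t ≠ nil) (s : ℕ) :
    ∃ x, s ≤ x ∧ x < s + t.numNodes ∧ t.gap s x = true := by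
  induction t generalizing s with
  | nil => exact absurd rfl hne
  | node v l r hl hr =>
    obtain ⟨h1, h2, h3⟩ := ht
    rw [numNodes]
    by_cases hln : l = nil
    · by_cases hrn : r = nil
      · refine ⟨s, le_rfl, by omega, ?_⟩
        simp [gap, hln, h1 hln hrn]
      · obtain ⟨x, h4, h5, h6⟩ := hr h3 hrn (s + l.numNodes + 1)
        refine ⟨x, by omega, by omega, ?_⟩
        rwa [gap, if_neg (by omega), if_neg (by omega)]
    · obtain ⟨x, h4, h5, h6⟩ := hl h2 hln s
      refine ⟨x, by omega, by omega, ?_⟩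
      rwa [gap, if_pos h5]

/-- A childless node is a chord between neighbouring points, so its single gap must be a jump; any
other chord has a childless node below it. -/
theorem leavesTrue_iff {t : BinaryTree Bool} (s : ℕ) :
    t.LeavesTrue ↔
      ∀ a b, (a, b) ∈ t.edges s → ∃ x, a ≤ x ∧ x < b ∧ t.gap s x = true := by
  induction t generalizing s with
  | nil => simp [LeavesTrue, edges]
  | node v l r hl hr =>
    constructor
    · intro ht a b hab
      rcases mem_edges_node.1 hab with ⟨rfl, rfl⟩ | h | h
      · obtain ⟨x, h1, h2, h3⟩ := ht.exists_gap (by simp) a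
        rw [numNodes] at h2
        exact ⟨x, h1, by omega, h3⟩
      · obtain ⟨x, h1, h2, h3⟩ := (hl s).1 ht.2.1 a b h
        have := bounds_of_mem_edges h
        refine ⟨x, h1, h2, ?_⟩
        rwa [gap, if_pos (by omega)]
      · obtain ⟨x, h1, h2, h3⟩ := (hr _).1 ht.2.2 a b h
        have := bounds_of_mem_edges h
        refine ⟨x, h1, h2, ?_⟩
        rwa [gap, if_neg (by omega), if_neg (by omega)]
    · intro h
      refine ⟨?_, (hl s).2 fun a b hab => ?_, (hr (s + l.numNodes + 1)).2 fun a b hab => ?_⟩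
      · rintro rfl rfl
        obtain ⟨x, h1, h2, h3⟩ := h _ _ (mem_edges_root (by simp) s)
        simp only [numNodes] at h2
        obtain rfl : x = s := by omega
        simpa [gap] using h3
      · obtain ⟨x, h1, h2, h3⟩ := h a b (mem_edges_node.2 (Or.inr (Or.inl hab)))
        have := bounds_of_mem_edges hab
        rw [gap, if_pos (by omega)] at h3
        exact ⟨x, h1, h2, h3⟩
      · obtain ⟨x, h1, h2, h3⟩ := h a b (mem_edges_node.2 (Or.inr (Or.inr hab)))
        have := bounds_of_mem_edges hab
        rw [gap, if_neg (by omega), if_neg (by omega)] at h3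
        exact ⟨x, h1, h2, h3⟩

/-- The upper end of the root chord is new exactly when the right subtree is empty; otherwise it is
already the upper end of the right subtree's root chord. -/
theorem card_image_snd_edges {α : Type*} (t : BinaryTree α) (s : ℕ) :
    ((t.edges s).image Prod.snd).card = t.numUpper := by
  have bound : ∀ {t : BinaryTree α} {s b : ℕ}, b ∈ (t.edges s).image Prod.snd →
      s < b ∧ b ≤ s + t.numNodes := by
    intro t s b hb
    obtain ⟨⟨a, b⟩, h, rfl⟩ := Finset.mem_image.1 hb
    have := bounds_of_mem_edges h
    exact ⟨by dsimp only; omega, this.2.2⟩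
  induction t generalizing s with
  | nil => simp [edges, numUpper]
  | node v l r hl hr =>
    rw [edges, Finset.image_insert, Finset.image_union]
    cases r with
    | nil =>
      rw [numUpper, Finset.card_insert_of_notMem, ← hl s]
      · simp [edges]
      · intro h
        simp only [edges, Finset.image_empty, Finset.union_empty, numNodes] at h
        have := bound h
        omega
    | node w a b =>
      rw [numUpper, ← hl s, ← hr (s + l.numNodes + 1), Finset.insert_eq_of_mem,
        Finset.card_union_of_disjoint]
      · rw [Finset.disjoint_left]
        intro x h1 h2
        have := bound h1
        have := bound h2
        omega
      · refine Finset.mem_union_right _ (Finset.mem_image.2 ⟨_, mem_edges_root (by simp) _, ?_⟩)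
        simp only
        omega

end BinaryTree

theorem Nat.count_lt_count_iff_exists {p : ℕ → Prop} [DecidablePred p] {a b : ℕ} :
    Nat.count p a < Nat.count p b ↔ ∃ x, a ≤ x ∧ x < b ∧ p x := by
  constructor
  · intro h
    induction b with
    | zero => simp at h
    | succ b ih =>
      by_cases hb : p b
      · refine ⟨b, ?_, by omega, hb⟩
        by_contra! hab
        exact absurd (Nat.count_monotone p (show b + 1 ≤ a by omega)) (by omega)
      · rw [Nat.count_succ, if_neg hb] at h
        obtain ⟨x, h1, h2, h3⟩ := ih h
        exact ⟨x, h1, by omega, h3⟩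
  · rintro ⟨x, h1, h2, h3⟩
    calc Nat.count p a ≤ Nat.count p x := Nat.count_monotone p h1
      _ < Nat.count p (x + 1) := Nat.count_lt_count_succ_iff.2 h3
      _ ≤ Nat.count p b := Nat.count_monotone p h2

theorem Nat.exists_count_eq {p : ℕ → Prop} [DecidablePred p] {i b : ℕ} (h : i ≤ Nat.count p b) :
    ∃ x ≤ b, Nat.count p x = i := by
  induction b with
  | zero => exact ⟨0, le_rfl, by simp at h ⊢; omega⟩
  | succ b ih =>
    by_cases hi : i ≤ Nat.count p b
    · obtain ⟨x, h1, h2⟩ := ih hi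
      exact ⟨x, by omega, h2⟩
    · refine ⟨b + 1, le_rfl, ?_⟩
      rw [Nat.count_succ] at h ⊢
      split_ifs at h ⊢ <;> omega

/-! ### Structure of alternating GNC-trees -/

namespace GNCTree

variable {n : ℕ} (T : GNCTree n)

/-- The label of the point `x`, extended to all natural numbers by the label of the last point. -/
def labelNat (x : ℕ) : ℕ := T.label ⟨min x n, by omega⟩

theorem labelNat_val (v : Fin (n + 1)) : T.labelNat v = T.label v := by
  unfold labelNat
  congr 1
  ext
  simp only
  omega

theorem labelNat_mono : Monotone T.labelNat := fun _ _ hxy =>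
  T.label_mono (Fin.mk_le_mk.2 (min_le_min_right n hxy))

theorem labelNat_zero : T.labelNat 0 = 1 := by
  have h1 := T.label_pos ⟨min 0 n, by omega⟩
  obtain ⟨w, hw⟩ := T.label_initial ⟨min 0 n, by omega⟩ 1 le_rfl h1
  have h2 : T.labelNat 0 ≤ 1 := by
    rw [← hw, ← T.labelNat_val]
    exact T.labelNat_mono (Nat.zero_le _)
  exact le_antisymm h2 h1

theorem labelNat_succ_le (x : ℕ) : T.labelNat (x + 1) ≤ T.labelNat x + 1 := by
  by_contra! h
  obtain ⟨w, hw⟩ := T.label_initial ⟨min (x + 1) n, by omega⟩ (T.labelNat x + 1) (by omega) h.le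
  rw [← T.labelNat_val] at hw
  rcases le_or_gt (w : ℕ) x with h1 | h1
  · have := T.labelNat_mono h1; omega
  · have := T.labelNat_mono (show x + 1 ≤ w from h1); omega

/-- Labels start at 1 and skip no value, so each step is 0 or 1 and the positions of the jumps
determine them. -/
theorem labelNat_eq_count (x : ℕ) :
    T.labelNat x = 1 + Nat.count (fun y => T.labelNat y < T.labelNat (y + 1)) x := by
  induction x with
  | zero => simp [labelNat_zero]
  | succ x ih =>
    have h1 := T.labelNat_succ_le x
    have h2 := T.labelNat_mono (Nat.le_add_right x 1)
    rw [Nat.count_succ]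
    split_ifs with h
    · omega
    · omega

theorem labelNat_lt_iff {a b : ℕ} :
    T.labelNat a < T.labelNat b ↔
      ∃ x, a ≤ x ∧ x < b ∧ T.labelNat x < T.labelNat (x + 1) := by
  rw [T.labelNat_eq_count a, T.labelNat_eq_count b, Nat.add_lt_add_iff_left]
  exact Nat.count_lt_count_iff_exists

theorem word_concat {a b c : Fin (n + 1)} (p : T.graph.Walk a b) (h : T.graph.Adj b c) :
    T.word (p.concat h) = T.word p ++ [EdgeStep.ofLabels (T.label b) (T.label c)] := by
  simp [word, SimpleGraph.Walk.darts_concat]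

variable {T}

/-- One end of the edge is off the root path to the other; extending that path by the edge would
append the letter `h`. -/
theorem IsAlternating.label_ne (hT : T.IsAlternating) {a b : Fin (n + 1)}
    (hab : T.graph.Adj a b) : T.label a ≠ T.label b := by
  have key : ∀ {a b : Fin (n + 1)} (p : T.graph.Walk 0 a), p.IsPath → b ∉ p.support →
      T.graph.Adj a b → T.label a ≠ T.label b := by
    intro a b p hp hb hab heq
    refine hT.2.2 b (p.concat hab) (hp.concat hb hab) ⟨T.word p, [], ?_⟩
    rw [T.word_concat, heq]
    simp [EdgeStep.ofLabels]
  obtain ⟨p, hp⟩ := (T.isTree.existsUnique_path 0 a).exists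
  obtain ⟨q, hq⟩ := (T.isTree.existsUnique_path 0 b).exists
  by_cases hb : b ∈ p.support
  · exact (key q hq (T.isTree.isAcyclic.ne_mem_support_of_support_of_adj_of_isPath hp hq hab hb)
      hab.symm).symm
  · exact key p hp hb hab

theorem IsAlternating.label_lt (hT : T.IsAlternating) {a b : Fin (n + 1)}
    (hab : T.graph.Adj a b) (h : a < b) : T.label a < T.label b :=
  lt_of_le_of_ne (T.label_mono h.le) (hT.label_ne hab)

/-- Let `x` precede `b` on its root path. If `x < b`, continuing to `c` produces `uu`; if `x > b`,
continuing to `a` produces `dd`. The extension is a path because `x` is the only neighbour of `b` on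
the root path. -/
theorem IsAlternating.not_adj_of_adj (hT : T.IsAlternating) {a b c : Fin (n + 1)} (h1 : a < b)
    (h2 : b < c) (hab : T.graph.Adj a b) (hbc : T.graph.Adj b c) : False := by
  obtain ⟨p, hp⟩ := (T.isTree.existsUnique_path 0 b).exists
  have hnil : ¬ p.Nil := fun h => by
    have := h.eq
    exact absurd h1 (by rw [← this]; simp)
  have hx := p.adj_penultimate hnil
  set x := p.penultimate with hxdef
  have hw : T.word p =
      T.word p.dropLast ++ [EdgeStep.ofLabels (T.label x) (T.label b)] := by
    rw [← T.word_concat _ hx, SimpleGraph.Walk.concat_dropLast]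
  have hac := T.isTree.isAcyclic
  rcases lt_or_gt_of_ne hx.ne with hxb | hxb
  · have hc : c ∉ p.support := fun hc => by
      have := hac.eq_penultimate_of_adj_end hp hbc hc
      rw [this] at h2
      exact lt_asymm h2 hxb
    refine hT.1 c (p.concat hbc) (hp.concat hc hbc) ⟨T.word p.dropLast, [], ?_⟩
    rw [T.word_concat, hw]
    simp [EdgeStep.ofLabels, hT.label_lt hx hxb, hT.label_lt hbc h2]
  · have ha : a ∉ p.support := fun ha => by
      have := hac.eq_penultimate_of_adj_end hp hab.symm ha
      rw [this] at h1
      exact lt_asymm h1 hxb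
    refine hT.2.1 a (p.concat hab.symm) (hp.concat ha hab.symm) ⟨T.word p.dropLast, [], ?_⟩
    have l1 := hT.label_lt hx.symm hxb
    have l2 := hT.label_lt hab h1
    rw [T.word_concat, hw]
    simp [EdgeStep.ofLabels, l1.not_gt, l2.not_gt, l1.ne', l2.ne']

theorem isAlternating_of_forall (h1 : ∀ a b, T.graph.Adj a b → T.label a ≠ T.label b)
    (h2 : ∀ a b c, a < b → b < c → T.graph.Adj a b → ¬ T.graph.Adj b c) : T.IsAlternating := by
  have pair : ∀ {v : Fin (n + 1)} (p : T.graph.Walk 0 v) (s₁ s₂ : EdgeStep),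
      [s₁, s₂] <:+: T.word p → ∃ a b c, T.graph.Adj a b ∧ T.graph.Adj b c ∧
        EdgeStep.ofLabels (T.label a) (T.label b) = s₁ ∧
        EdgeStep.ofLabels (T.label b) (T.label c) = s₂ := by
    rintro v p s₁ s₂ ⟨l, l', hl⟩
    have hch := p.isChain_dartAdj_darts
    unfold word at hl
    obtain ⟨m, m', hm, hm1, hm2⟩ := List.map_eq_append_iff.1 hl.symm
    obtain ⟨k, k', rfl, hk1, hk2⟩ := List.map_eq_append_iff.1 hm1
    obtain ⟨d, k'', rfl, hd, hk''⟩ := List.map_eq_cons_iff.1 hk2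
    obtain ⟨d', k3, rfl, hd', hk3⟩ := List.map_eq_cons_iff.1 hk''
    rw [hm] at hch
    have hadj : T.graph.DartAdj d d' := by
      have := hch.left_of_append.right_of_append
      simpa using this.rel
    refine ⟨d.fst, d.snd, d'.snd, d.adj, ?_, hd, ?_⟩
    · rw [show d.snd = d'.fst from hadj]; exact d'.adj
    · rw [show d.snd = d'.fst from hadj]; exact hd'
  refine ⟨fun v p _ h => ?_, fun v p _ h => ?_, fun v p _ h => ?_⟩
  · obtain ⟨a, b, c, hab, hbc, e1, e2⟩ := pair p _ _ h
    have l1 : T.label a < T.label b := by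
      unfold EdgeStep.ofLabels at e1
      by_contra hlt
      rw [if_neg hlt] at e1
      split_ifs at e1
    have l2 : T.label b < T.label c := by
      unfold EdgeStep.ofLabels at e2
      by_contra hlt
      rw [if_neg hlt] at e2
      split_ifs at e2
    exact h2 a b c (T.label_mono.reflect_lt l1) (T.label_mono.reflect_lt l2) hab hbc
  · obtain ⟨a, b, c, hab, hbc, e1, e2⟩ := pair p _ _ h
    have l1 : T.label b < T.label a := by
      unfold EdgeStep.ofLabels at e1
      split_ifs at e1
      omega
    have l2 : T.label c < T.label b := by
      unfold EdgeStep.ofLabels at e2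
      split_ifs at e2
      omega
    exact h2 c b a (T.label_mono.reflect_lt l2) (T.label_mono.reflect_lt l1) hbc.symm hab.symm
  · have hmem : EdgeStep.h ∈ T.word p := h.subset (List.mem_singleton_self _)
    obtain ⟨d, -, hd⟩ := List.mem_map.1 hmem
    unfold EdgeStep.ofLabels at hd
    have := h1 _ _ d.adj
    split_ifs at hd

/-- The edges of the tree as a relation on the natural numbers, from the smaller end point to the
larger one. -/
def EdgeRel (T : GNCTree n) (a b : ℕ) : Prop :=
  a < b ∧ ∃ (ha : a < n + 1) (hb : b < n + 1), T.graph.Adj ⟨a, ha⟩ ⟨b, hb⟩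

theorem edgeRel_val {a b : Fin (n + 1)} : T.EdgeRel a b ↔ a < b ∧ T.graph.Adj a b := by
  exact ⟨fun h => ⟨h.1, h.2.2.2⟩, fun h => ⟨h.1, a.isLt, b.isLt, h.2⟩⟩

theorem connectsInterval_edgeRel (T : GNCTree n) : ConnectsInterval T.EdgeRel 0 (0 + n) := by
  rintro S ⟨x, hx, -, hxn⟩ hS y - hyn
  have step : ∀ a b : Fin (n + 1), T.graph.Adj a b → (a : ℕ) ∈ S → (b : ℕ) ∈ S := by
    intro a b hab ha
    rcases lt_or_gt_of_ne hab.ne with h | h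
    · exact (hS a b (edgeRel_val.2 ⟨h, hab⟩) (Nat.zero_le _) (by omega)).1 ha
    · exact (hS b a (edgeRel_val.2 ⟨h, hab.symm⟩) (Nat.zero_le _) (by omega)).2 ha
  have walk : ∀ {a b : Fin (n + 1)}, T.graph.Walk a b → (a : ℕ) ∈ S → (b : ℕ) ∈ S := by
    intro a b p
    induction p with
    | nil => exact id
    | cons h p ih => exact fun ha => ih (step _ _ h ha)
  obtain ⟨p⟩ := T.isTree.connected.preconnected ⟨x, by omega⟩ ⟨y, by omega⟩
  exact walk p hx

/-- The binary tree `t` encodes the graph and the labels of `T`. -/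
def EncodedBy (T : GNCTree n) (t : BinaryTree Bool) : Prop :=
  t.numNodes = n ∧ (∀ a b, T.EdgeRel a b ↔ (a, b) ∈ t.edges 0) ∧
    ∀ x, x < n → (t.gap 0 x = true ↔ T.labelNat x < T.labelNat (x + 1))

theorem EncodedBy.label_lt_iff {t : BinaryTree Bool} (h : T.EncodedBy t) {a b : Fin (n + 1)} :
    T.label a < T.label b ↔ ∃ x, (a : ℕ) ≤ x ∧ x < b ∧ t.gap 0 x = true := by
  rw [← T.labelNat_val, ← T.labelNat_val, T.labelNat_lt_iff]
  refine exists_congr fun x => and_congr_right fun h1 => and_congr_right fun h2 => ?_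
  rw [h.2.2 x (by omega)]

theorem EncodedBy.isAlternating_iff {t : BinaryTree Bool} (h : T.EncodedBy t) :
    T.IsAlternating ↔ t.LeavesTrue := by
  rw [BinaryTree.leavesTrue_iff 0]
  constructor
  · intro hT a b hab
    obtain ⟨hlt, ha, hb, hadj⟩ := (h.2.1 a b).2 hab
    exact h.label_lt_iff.1 (hT.label_lt hadj hlt)
  · intro ht
    have lt : ∀ a b, a < b → T.graph.Adj a b → T.label a < T.label b := fun a b hab hadj =>
      h.label_lt_iff.2 (ht a b ((h.2.1 a b).1 (edgeRel_val.2 ⟨hab, hadj⟩)))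
    refine isAlternating_of_forall (fun a b hab => ?_) fun a b c hab hbc h1 h2 => ?_
    · rcases lt_or_gt_of_ne hab.ne with hlt | hlt
      · exact (lt a b hlt hab).ne
      · exact (lt b a hlt hab.symm).ne'
    · exact BinaryTree.edges_alternating ((h.2.1 a b).1 (edgeRel_val.2 ⟨hab, h1⟩))
        ((h.2.1 b c).1 (edgeRel_val.2 ⟨hbc, h2⟩))

theorem IsAlternating.exists_encodedBy (hT : T.IsAlternating) :
    ∃ t : BinaryTree Bool, T.EncodedBy t := by
  obtain ⟨t, h1, h2, h3⟩ := BinaryTree.exists_edges (R := T.EdgeRel) (fun a b h => h.1)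
    (by
      rintro a b c d hab hbc hcd ⟨-, ha, hc, h1⟩ ⟨-, hb, hd, h2⟩
      exact T.nonCrossing _ _ _ _ (Fin.mk_lt_mk.2 hab) (Fin.mk_lt_mk.2 hbc) (Fin.mk_lt_mk.2 hcd)
        ⟨h1, h2⟩)
    (by
      rintro a b c ⟨hab, ha, hb, h1⟩ ⟨hbc, _, hc, h2⟩
      exact hT.not_adj_of_adj (Fin.mk_lt_mk.2 hab) (Fin.mk_lt_mk.2 hbc) h1 h2)
    (fun x => decide (T.labelNat x < T.labelNat (x + 1))) n 0 T.connectsInterval_edgeRel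
  refine ⟨t, h1, fun a b => ⟨fun h => ?_, fun h => ?_⟩, fun x hx => ?_⟩
  · obtain ⟨-, -, hb, -⟩ := id h
    exact (h2 a b (Nat.zero_le _) (by omega)).1 h
  · have := BinaryTree.bounds_of_mem_edges h
    exact (h2 a b (Nat.zero_le _) (by omega)).2 h
  · rw [h3 x (Nat.zero_le _) (by omega), decide_eq_true_iff]

theorem EncodedBy.unique {t t' : BinaryTree Bool} (h : T.EncodedBy t) (h' : T.EncodedBy t') :
    t = t' :=
  BinaryTree.eq_of_edges_eq_of_gap_eq (s := 0) (h.1.trans h'.1.symm)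
    (fun a b => (h.2.1 a b).symm.trans (h'.2.1 a b)) fun x _ hx => by
      have hx' : x < n := by have := h.1; omega
      rw [Bool.eq_iff_iff, h.2.2 x hx', h'.2.2 x hx']

theorem EncodedBy.unique_left {t : BinaryTree Bool} {S T : GNCTree n} (h : S.EncodedBy t)
    (h' : T.EncodedBy t) : S = T := by
  have aux : ∀ a b, a < b → (S.graph.Adj a b ↔ T.graph.Adj a b) := by
    intro a b hab
    have := (h.2.1 a b).trans (h'.2.1 a b).symm
    simpa [edgeRel_val, hab] using this
  refine GNCTree.ext ?_ (funext fun v => ?_)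
  · ext a b
    rcases lt_trichotomy a b with hab | rfl | hab
    · exact aux a b hab
    · simp
    · rw [S.graph.adj_comm, T.graph.adj_comm]
      exact aux b a hab
  · have key : ∀ x, x ≤ n → S.labelNat x = T.labelNat x := by
      intro x
      induction x with
      | zero => intro _; rw [labelNat_zero, labelNat_zero]
      | succ x ih =>
        intro hx
        have h0 := ih (by omega)
        have h1 := (h.2.2 x (by omega)).symm.trans (h'.2.2 x (by omega))
        have h2 := S.labelNat_succ_le x
        have h3 := T.labelNat_succ_le x
        have h4 := S.labelNat_mono (Nat.le_add_right x 1)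
        have h5 := T.labelNat_mono (Nat.le_add_right x 1)
        omega
    rw [← S.labelNat_val, ← T.labelNat_val]
    exact key v (by omega)

end GNCTree

/-! ### The GNC-tree of a binary tree -/

namespace BinaryTree

variable {n : ℕ}

/-- The graph on `0, 1, …, n` with the chords of `t`. -/
def graph {α : Type*} (t : BinaryTree α) (n : ℕ) : SimpleGraph (Fin (n + 1)) :=
  SimpleGraph.fromRel fun a b => ((a : ℕ), (b : ℕ)) ∈ t.edges 0

theorem graph_adj {α : Type*} {t : BinaryTree α} {a b : Fin (n + 1)} :
    (t.graph n).Adj a b ↔ ((a : ℕ), (b : ℕ)) ∈ t.edges 0 ∨ ((b : ℕ), (a : ℕ)) ∈ t.edges 0 := by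
  rw [graph, SimpleGraph.fromRel_adj, and_iff_right_iff_imp]
  rintro (h | h) rfl
  · have := bounds_of_mem_edges h; omega
  · have := bounds_of_mem_edges h; omega

theorem graph_adj_of_lt {α : Type*} {t : BinaryTree α} {a b : Fin (n + 1)} (hab : a < b) :
    (t.graph n).Adj a b ↔ ((a : ℕ), (b : ℕ)) ∈ t.edges 0 := by
  rw [graph_adj, or_iff_left]
  intro h
  have := bounds_of_mem_edges h
  omega

theorem isTree_graph {α : Type*} {t : BinaryTree α} (hn : t.numNodes = n) :
    (t.graph n).IsTree := by
  have hconn : (t.graph n).Connected := by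
    have h0 : ∀ v : Fin (n + 1), (t.graph n).Reachable 0 v := by
      intro v
      have := t.connectsInterval_edges 0
        {x | ∃ hx : x < n + 1, (t.graph n).Reachable 0 ⟨x, hx⟩}
        ⟨0, ⟨by omega, SimpleGraph.Reachable.refl _⟩, le_rfl, by omega⟩
        (fun a b hab ha hb => by
          have h1 := bounds_of_mem_edges hab
          have hadj : (t.graph n).Adj ⟨a, by omega⟩ ⟨b, by omega⟩ := graph_adj.2 (Or.inl hab)
          exact ⟨fun ⟨_, h⟩ => ⟨by omega, h.trans hadj.reachable⟩,
            fun ⟨_, h⟩ => ⟨by omega, h.trans hadj.symm.reachable⟩⟩) v (Nat.zero_le _) (by omega)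
      exact this.2
    exact SimpleGraph.Connected.mk fun u v => (h0 u).symm.trans (h0 v)
  refine SimpleGraph.isTree_iff_connected_and_card.2 ⟨hconn, ?_⟩
  have h1 := hconn.card_vert_le_card_edgeSet_add_one
  refine le_antisymm ?_ h1
  have bound : ∀ p ∈ t.edges 0, p.1 < n + 1 ∧ p.2 < n + 1 := fun p hp => by
    have := bounds_of_mem_edges (a := p.1) (b := p.2) hp
    omega
  have h2 : Nat.card (t.graph n).edgeSet ≤ Nat.card (t.edges 0) := by
    refine Nat.card_le_card_of_surjective (fun p : t.edges 0 =>
      (⟨s(⟨p.1.1, bound p.1 p.2 |>.1⟩,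
        ⟨p.1.2, bound p.1 p.2 |>.2⟩),
        graph_adj.2 (Or.inl p.2)⟩ : (t.graph n).edgeSet)) ?_
    rintro ⟨e, he⟩
    induction e using Sym2.ind with
    | _ a b =>
      rcases graph_adj.1 he with h | h
      · exact ⟨⟨_, h⟩, rfl⟩
      · exact ⟨⟨_, h⟩, Subtype.ext Sym2.eq_swap⟩
  have h3 := t.card_edges_le 0
  rw [Nat.card_eq_fintype_card (α := t.edges 0), Fintype.card_coe] at h2
  rw [Nat.card_eq_fintype_card (α := Fin (n + 1)), Fintype.card_fin]
  omega

/-- The labelled non-crossing tree encoded by `t`. -/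
def toGNCTree (t : BinaryTree Bool) (n : ℕ) (hn : t.numNodes = n) : GNCTree n where
  graph := t.graph n
  isTree := isTree_graph hn
  nonCrossing := by
    rintro a b c d hab hbc hcd ⟨h1, h2⟩
    rw [graph_adj_of_lt (hab.trans hbc)] at h1
    rw [graph_adj_of_lt (hbc.trans hcd)] at h2
    exact edges_nonCrossing h1 h2 hab hbc hcd
  label v := 1 + Nat.count (fun x => t.gap 0 x = true) v
  label_pos v := Nat.le_add_right _ _
  label_mono a b hab := Nat.add_le_add_left (Nat.count_monotone _ hab) 1
  label_initial v i h1 h2 := by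
    obtain ⟨x, hx, h3⟩ := Nat.exists_count_eq
      (show i - 1 ≤ Nat.count (fun x => t.gap 0 x = true) v by omega)
    exact ⟨⟨x, by omega⟩, by simp only [h3]; omega⟩

theorem encodedBy_toGNCTree {t : BinaryTree Bool} (hn : t.numNodes = n) :
    (t.toGNCTree n hn).EncodedBy t := by
  refine ⟨hn, fun a b => ⟨?_, fun h => ?_⟩, fun x hx => ?_⟩
  · rintro ⟨hab, ha, hb, h⟩
    exact (graph_adj_of_lt (Fin.mk_lt_mk.2 hab)).1 h
  · have := bounds_of_mem_edges h
    exact ⟨this.2.1, by omega, by omega, graph_adj.2 (Or.inl h)⟩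
  · simp only [GNCTree.labelNat, toGNCTree, Nat.min_eq_left hx.le, Nat.add_lt_add_iff_left,
      Nat.min_eq_left (show x + 1 ≤ n from hx)]
    exact (Nat.count_lt_count_succ_iff (p := fun x => t.gap 0 x = true)).symm

end BinaryTree

/-! ### Ascents and the bijection -/

namespace GNCTree

variable {n : ℕ} {T : GNCTree n}

theorem EncodedBy.ncard_ascents {t : BinaryTree Bool} (h : T.EncodedBy t)
    (hT : T.IsAlternating) : T.ascents.ncard = t.numUpper := by
  have hac := T.isTree.isAcyclic
  -- An ascent into a point comes from its parent, so ascents can be counted by their end points.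
  have hpar : ∀ e ∈ T.ascents, ∀ p : T.graph.Walk 0 e.2, p.IsPath → e.1 = p.penultimate := by
    rintro ⟨i, j⟩ ⟨hadj, ⟨q, hq, hi⟩, -⟩ p hp
    exact (T.isTree.existsUnique_path 0 j).unique hq hp ▸
      hac.eq_penultimate_of_adj_end hq hadj.symm hi
  have hinj : Set.InjOn (fun e : Fin (n + 1) × Fin (n + 1) => (e.2 : ℕ)) T.ascents := by
    rintro ⟨i, j⟩ he ⟨i', j'⟩ he' hjj
    obtain rfl : j = j' := Fin.ext hjj
    obtain ⟨p, hp⟩ := (T.isTree.existsUnique_path 0 j).exists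
    rw [show i = p.penultimate from hpar _ he p hp, show i' = p.penultimate from hpar _ he' p hp]
  have himg : (fun e : Fin (n + 1) × Fin (n + 1) => (e.2 : ℕ)) '' T.ascents =
      ((t.edges 0).image Prod.snd : Finset ℕ) := by
    ext j
    simp only [Set.mem_image, Finset.coe_image, Finset.mem_coe, Prod.exists]
    constructor
    · rintro ⟨i, j, ⟨hadj, -, hlt⟩, rfl⟩
      exact ⟨i, j, (h.2.1 i j).1 (edgeRel_val.2 ⟨T.label_mono.reflect_lt hlt, hadj⟩), rfl⟩
    · rintro ⟨i, j, hij, rfl⟩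
      obtain ⟨hlt, hi, hj, hadj⟩ := (h.2.1 i j).2 hij
      obtain ⟨p, hp⟩ := (T.isTree.existsUnique_path 0 ⟨j, hj⟩).exists
      have hnil : ¬ p.Nil := fun hnil => by
        have := congrArg Fin.val hnil.eq
        simp only [Fin.val_zero] at this
        omega
      have hx := p.adj_penultimate hnil
      -- The parent of `j` need not be `i`, but since `j` has the smaller neighbour `i`, alternation
      -- makes all its neighbours smaller.
      have hxj : p.penultimate < ⟨j, hj⟩ := by
        rcases lt_or_gt_of_ne hx.ne with hxj | hxj
        · exact hxj
        · exact (hT.not_adj_of_adj (Fin.mk_lt_mk.2 hlt) hxj hadj hx.symm).elim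
      exact ⟨p.penultimate, ⟨j, hj⟩,
        ⟨hx, ⟨p, hp, p.getVert_mem_support _⟩, hT.label_lt hx hxj⟩, rfl⟩
  rw [← hinj.ncard_image, himg, Set.ncard_coe_finset, t.card_image_snd_edges]

/-- Alternating trees correspond to binary trees, ascents to the larger ends of chords. -/
theorem card_isAlternating_ascents (n : ℕ) (P : ℕ → Prop) :
    Nat.card {T : GNCTree n // T.IsAlternating ∧ P T.ascents.ncard} =
      Nat.card {t : BinaryTree Bool // t.numNodes = n ∧ t.LeavesTrue ∧ P t.numUpper} := by
  choose f hf using fun T : {T : GNCTree n // T.IsAlternating ∧ P T.ascents.ncard} =>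
    T.2.1.exists_encodedBy
  refine Nat.card_eq_of_bijective
    (fun T => ⟨f T, (hf T).1, (hf T).isAlternating_iff.1 T.2.1,
      by rw [← (hf T).ncard_ascents T.2.1]; exact T.2.2⟩) ⟨fun S T hST => ?_, ?_⟩
  · have hft : f S = f T := congrArg Subtype.val hST
    exact Subtype.ext ((hf S).unique_left (hft ▸ hf T))
  · rintro ⟨t, hn, ht, hr⟩
    have henc := BinaryTree.encodedBy_toGNCTree hn
    have halt := henc.isAlternating_iff.2 ht
    exact ⟨⟨t.toGNCTree n hn, halt, by rwa [henc.ncard_ascents halt]⟩,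
      Subtype.ext ((hf _).unique henc)⟩

end GNCTree

/-! ### Weighted enumeration of binary trees -/

namespace BinaryTree

/-- The binary trees with `n` nodes and values in `Bool`. -/
def ofNumNodes : ℕ → Finset (BinaryTree Bool)
  | 0 => {nil}
  | n + 1 =>
      (Finset.HasAntidiagonal.antidiagonal n).attach.biUnion fun ij =>
        have _ := Finset.HasAntidiagonal.antidiagonal.fst_le ij.2
        have _ := Finset.HasAntidiagonal.antidiagonal.snd_le ij.2
        ((Finset.univ : Finset Bool) ×ˢ (ofNumNodes ij.1.1 ×ˢ ofNumNodes ij.1.2)).image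
          fun p => node p.1 p.2.1 p.2.2

theorem mem_ofNumNodes {n : ℕ} {t : BinaryTree Bool} : t ∈ ofNumNodes n ↔ t.numNodes = n := by
  induction t generalizing n with
  | nil => cases n <;> simp [ofNumNodes]
  | node v l r hl hr =>
    cases n with
    | zero => simp [ofNumNodes]
    | succ n => simp [ofNumNodes, hl, hr]

theorem sum_ofNumNodes_succ {M : Type*} [AddCommMonoid M] (n : ℕ) (f : BinaryTree Bool → M) :
    ∑ t ∈ ofNumNodes (n + 1), f t =
      ∑ ij ∈ Finset.HasAntidiagonal.antidiagonal n, ∑ l ∈ ofNumNodes ij.1, ∑ r ∈ ofNumNodes ij.2,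
        (f (node true l r) + f (node false l r)) := by
  rw [ofNumNodes, Finset.sum_biUnion, Finset.sum_attach (Finset.HasAntidiagonal.antidiagonal n) fun ij =>
    ∑ t ∈ ((Finset.univ : Finset Bool) ×ˢ (ofNumNodes ij.1 ×ˢ ofNumNodes ij.2)).image
      (fun p => node p.1 p.2.1 p.2.2), f t]
  · refine Finset.sum_congr rfl fun ij _ => ?_
    rw [Finset.sum_image, Finset.sum_product, Fintype.sum_bool, Finset.sum_product,
      Finset.sum_product, ← Finset.sum_add_distrib]
    · exact Finset.sum_congr rfl fun l _ => Finset.sum_add_distrib.symm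
    · rintro ⟨v, l, r⟩ - ⟨v', l', r'⟩ - h
      simpa using h
  · rintro ⟨⟨i, j⟩, hij⟩ - ⟨⟨i', j'⟩, hij'⟩ - hne
    rw [Function.onFun, Finset.disjoint_left]
    rintro t h1 h2
    obtain ⟨⟨v, l, r⟩, h3, rfl⟩ := Finset.mem_image.1 h1
    obtain ⟨⟨v', l', r'⟩, h4, h5⟩ := Finset.mem_image.1 h2
    simp only [Finset.mem_product, mem_ofNumNodes] at h3 h4
    simp only [node.injEq] at h5
    refine hne (Subtype.ext (Prod.ext ?_ ?_))
    · simp only; rw [← h3.2.1, ← h4.2.1, h5.2.1]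
    · simp only; rw [← h3.2.2, ← h4.2.2, h5.2.2]

variable {R : Type*} [CommRing R] (q : R)

open Classical in
/-- The contribution of `t` to the generating function by number of upper ends. -/
noncomputable def weight (t : BinaryTree Bool) : R :=
  if t.LeavesTrue then q ^ t.numUpper else 0

theorem weight_nil : weight q nil = 1 := by simp [weight, LeavesTrue, numUpper]

/-- The factor 2 is the free choice of value; an empty right subtree contributes `q` instead of 1
for the new upper end; the subtracted `q` removes the childless node with value `false`. -/
theorem weight_node_add (l r : BinaryTree Bool) :
    weight q (node true l r) + weight q (node false l r) =
      2 * weight q l * (weight q r + if r = nil then q - 1 else 0) -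
        if l = nil then (if r = nil then q else 0) else 0 := by
  cases r with
  | nil =>
    rw [weight_nil]
    by_cases hl : l = nil
    · subst hl
      simp [weight, LeavesTrue, numUpper]
      ring
    · by_cases hl' : l.LeavesTrue <;>
        simp [weight, LeavesTrue.eq_2 _ l, LeavesTrue.eq_1, hl, hl', numUpper]; ring
  | node w a b =>
    by_cases hl : l.LeavesTrue <;> by_cases hr : (node w a b).LeavesTrue <;>
      simp [weight, LeavesTrue.eq_2 _ l, hl, hr, numUpper]; ring

/-- The sum of the weights of all binary trees with `n` nodes. -/
noncomputable def totalWeight (n : ℕ) : R := ∑ t ∈ ofNumNodes n, weight q t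

theorem totalWeight_zero : totalWeight q 0 = 1 := by
  simp [totalWeight, ofNumNodes, weight_nil]

theorem sum_ofNumNodes_ite_nil (n : ℕ) (c : R) :
    ∑ t ∈ ofNumNodes n, (if t = nil then c else 0) = if n = 0 then c else 0 := by
  rw [Finset.sum_ite_eq']
  simp [mem_ofNumNodes, eq_comm]

theorem totalWeight_succ (n : ℕ) :
    totalWeight q (n + 1) =
      2 * ∑ ij ∈ Finset.HasAntidiagonal.antidiagonal n,
        totalWeight q ij.1 * (totalWeight q ij.2 + if ij.2 = 0 then q - 1 else 0) -
      if n = 0 then q else 0 := by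
  rw [totalWeight, sum_ofNumNodes_succ]
  have h : ∀ ij ∈ Finset.HasAntidiagonal.antidiagonal n, ∑ l ∈ ofNumNodes ij.1, ∑ r ∈ ofNumNodes ij.2,
      (weight q (node true l r) + weight q (node false l r)) =
      2 * (totalWeight q ij.1 * (totalWeight q ij.2 + if ij.2 = 0 then q - 1 else 0)) -
        if n = 0 then (if ij = (0, 0) then q else 0) else 0 := by
    rintro ⟨i, j⟩ hij
    rw [Finset.HasAntidiagonal.mem_antidiagonal] at hij
    simp only [weight_node_add, Finset.sum_sub_distrib]
    congr 1
    · simp only [← Finset.mul_sum, Finset.sum_add_distrib, sum_ofNumNodes_ite_nil, totalWeight]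
      rw [← Finset.sum_mul, ← Finset.mul_sum, mul_assoc]
    · have hl : ∀ l : BinaryTree Bool, (∑ r ∈ ofNumNodes j,
          if l = nil then (if r = nil then q else 0) else 0) =
          if l = nil then (if j = 0 then q else 0) else 0 := fun l => by
        split_ifs with h1 h2
        · rw [sum_ofNumNodes_ite_nil, if_pos h2]
        · rw [sum_ofNumNodes_ite_nil, if_neg h2]
        · simp
      simp only [hl, sum_ofNumNodes_ite_nil]
      by_cases hi : i = 0 <;> by_cases hj : j = 0 <;> simp_all
  rw [Finset.sum_congr rfl h, Finset.sum_sub_distrib, Finset.mul_sum]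
  congr 1
  split_ifs with h0
  · subst h0; simp
  · simp

theorem card_eq_totalWeight (n : ℕ) :
    ((Nat.card {t : BinaryTree Bool // t.numNodes = n ∧ t.LeavesTrue ∧ True} : ℕ) : R) =
      totalWeight 1 n := by
  classical
  have h : Nat.card {t : BinaryTree Bool // t.numNodes = n ∧ t.LeavesTrue ∧ True} =
      ((ofNumNodes n).filter LeavesTrue).card := by
    exact Nat.subtype_card _ fun t => by simp [mem_ofNumNodes]
  rw [h, totalWeight, Finset.card_filter]
  simp [weight]

theorem card_eq_coeff_totalWeight (n r : ℕ) :
    ((Nat.card {t : BinaryTree Bool // t.numNodes = n ∧ t.LeavesTrue ∧ t.numUpper = r} : ℕ) : R) =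
      (totalWeight (Polynomial.X : Polynomial R) n).coeff r := by
  classical
  have h : Nat.card {t : BinaryTree Bool // t.numNodes = n ∧ t.LeavesTrue ∧ t.numUpper = r} =
      ((ofNumNodes n).filter fun t => t.LeavesTrue ∧ t.numUpper = r).card :=
    Nat.subtype_card _ fun t => by simp [mem_ofNumNodes]
  rw [h, totalWeight, Finset.card_filter, Polynomial.finsetSum_coeff, Nat.cast_sum]
  refine Finset.sum_congr rfl fun t _ => ?_
  by_cases ht : t.LeavesTrue <;> simp [weight, ht, Polynomial.coeff_X_pow, eq_comm]

end BinaryTree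

/-! ### Power series and the quadratic equation -/

open PowerSeries in
-- Since `z ^ i` has no terms below degree `i`, only `i ≤ n` contributes.
theorem PowerSeries.coeff_mul_subst_of_constantCoeff_eq_zero {A R : Type*} [CommRing A]
    [CommRing R] [Algebra A R] (f : A⟦X⟧) (F : R⟦X⟧) {z : R⟦X⟧} (hz : constantCoeff z = 0)
    (n : ℕ) :
    coeff n (F * f.subst z) =
      ∑ i ∈ Finset.range (n + 1), algebraMap A R (coeff i f) * coeff n (F * z ^ i) := by
  have hzero : ∀ i m, m < i → coeff m (z ^ i) = 0 := fun i =>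
    X_pow_dvd_iff.1 (pow_dvd_pow_of_dvd (X_dvd_iff.2 hz) i)
  have hsubst : ∀ m ≤ n, coeff m (f.subst z) =
      ∑ i ∈ Finset.range (n + 1), algebraMap A R (coeff i f) * coeff m (z ^ i) := by
    intro m hm
    rw [coeff_subst' (HasSubst.of_constantCoeff_zero' hz), finsum_eq_sum_of_support_subset (s := Finset.range (n + 1))]
    · simp only [Algebra.smul_def]
    · intro i hi
      rw [Finset.coe_range, Set.mem_Iio]
      by_contra! hni
      exact hi (by simp only [hzero i m (by omega), smul_zero])
  rw [coeff_mul]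
  simp only [coeff_mul, Finset.mul_sum]
  rw [Finset.sum_comm]
  refine Finset.sum_congr rfl fun p hp => ?_
  rw [hsubst p.2 (Finset.HasAntidiagonal.antidiagonal.snd_le hp), Finset.mul_sum]
  exact Finset.sum_congr rfl fun i _ => by ring

open PowerSeries in
theorem PowerSeries.coeff_one_sub_C_mul_X_pow {R : Type*} [CommRing R] (q : R) (m j : ℕ) :
    coeff j ((1 - C q * X) ^ m) = (-q) ^ j * (m.choose j : R) := by
  have h : (1 - C q * X) ^ m =
      rescale (-q) (((1 + Polynomial.X) ^ m : Polynomial R) : R⟦X⟧) := by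
    simp [rescale_X, sub_eq_add_neg]
  rw [h, coeff_rescale, Polynomial.coeff_coe, Polynomial.coeff_one_add_X_pow]

namespace BinaryTree

open PowerSeries

variable {R : Type*} [CommRing R] (q : R)

theorem mk_totalWeight_eq :
    mk (totalWeight q) =
      1 + X * (2 * mk (totalWeight q) * (mk (totalWeight q) + C (q - 1)) - C q) := by
  ext n
  cases n with
  | zero => simp [totalWeight_zero]
  | succ n =>
    have h2 : (2 : R⟦X⟧) = C 2 := (map_ofNat (C : R →+* R⟦X⟧) 2).symm
    rw [coeff_mk, totalWeight_succ, map_add, coeff_succ_X_mul, map_sub, mul_assoc, h2,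
      coeff_C_mul, coeff_mul]
    simp only [map_add, coeff_mk, coeff_C, coeff_one]
    simp

/-- The solution of the quadratic equation for the generating function, with
`(1 + 2 (1 - q) X)⁻¹` written as a geometric series. -/
noncomputable def closedForm : R⟦X⟧ :=
  (1 - C q * X) * rescale (2 * (q - 1)) (mk 1) *
    (catalanSeries.map (Nat.castRingHom ℤ)).subst
      (2 * X * (1 - C q * X) * rescale (2 * (q - 1)) (mk 1) ^ 2 : R⟦X⟧)

theorem rescale_mk_one_mul (a : R) : rescale a (mk 1) * (1 - C a * X) = 1 := by
  have := congrArg (rescale a) (mk_one_mul_one_sub_eq_one R)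
  simpa [rescale_X] using this

theorem subst_catalanSeries_eq {z : R⟦X⟧} (hz : constantCoeff z = 0) :
    (catalanSeries.map (Nat.castRingHom ℤ)).subst z =
      1 + z * (catalanSeries.map (Nat.castRingHom ℤ)).subst z ^ 2 := by
  have hs := HasSubst.of_constantCoeff_zero' hz
  have h := congrArg (fun f => substAlgHom (R := ℤ) hs (f.map (Nat.castRingHom ℤ)))
    catalanSeries_sq_mul_X_add_one
  simp only [map_add, map_mul, map_pow, map_one, PowerSeries.map_X, substAlgHom_X] at h
  rw [coe_substAlgHom] at h
  linear_combination -h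

/-- With D = 1/(1 - 2(q-1)t), the quadratic reads F = (1-qt)D + 2tD F². Putting F = (1-qt)D·S turns
it into the Catalan equation S = 1 + zS² with z = 2t(1-qt)D². -/
theorem closedForm_eq :
    closedForm q = 1 + X * (2 * closedForm q * (closedForm q + C (q - 1)) - C q) := by
  have hC : C (2 * (q - 1)) = 2 * C (q - 1) := by
    rw [map_mul, map_ofNat]
  have hD := rescale_mk_one_mul (2 * (q - 1))
  have hS := subst_catalanSeries_eq
    (z := (2 * X * (1 - C q * X) * rescale (2 * (q - 1)) (mk 1) ^ 2 : R⟦X⟧)) (by simp)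
  rw [hC] at hD
  unfold closedForm
  generalize (catalanSeries.map (Nat.castRingHom ℤ)).subst
      (2 * X * (1 - C q * X) * rescale (2 * (q - 1)) (mk 1) ^ 2 : R⟦X⟧) = S at *
  generalize rescale (2 * (q - 1)) (mk 1 : R⟦X⟧) = D at *
  linear_combination (1 - C q * X) * hS + (1 - C q * X) * S * hD

theorem mk_totalWeight_eq_closedForm : mk (totalWeight q) = closedForm q := by
  have h1 := mk_totalWeight_eq q
  have h2 := closedForm_eq q
  generalize mk (totalWeight q) = F at *
  generalize closedForm q = G at *
  -- Subtracting the equations of two solutions leaves a factor with constant term 1, hence a unit.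
  have h3 : (1 - X * (2 * (F + G + C (q - 1)))) * (F - G) = 0 := by
    linear_combination h1 - h2
  have hu : IsUnit (1 - X * (2 * (F + G + C (q - 1)))) :=
    isUnit_iff_constantCoeff.2 (by simp)
  exact sub_eq_zero.1 ((hu.mul_right_eq_zero).1 h3)

theorem coeff_rescale_mk_one_pow (a : R) (d k : ℕ) :
    coeff k (rescale a (mk 1 : R⟦X⟧) ^ (d + 1)) = a ^ k * ((d + k).choose k : R) := by
  rw [← map_pow, mk_one_pow_eq_mk_choose_add, coeff_rescale, coeff_mk, Nat.choose_symm_add]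

theorem totalWeight_eq_sum (n : ℕ) :
    totalWeight q n =
      ∑ p ∈ Finset.HasAntidiagonal.antidiagonal n, ∑ s ∈ Finset.HasAntidiagonal.antidiagonal p.2,
        (catalan p.1 : R) * 2 ^ p.1 * ((-q) ^ s.1 * ((p.1 + 1).choose s.1 : R) *
          ((2 * (q - 1)) ^ s.2 * ((2 * p.1 + s.2).choose s.2 : R))) := by
  rw [← coeff_mk (R := R) n (totalWeight q), mk_totalWeight_eq_closedForm, closedForm,
    coeff_mul_subst_of_constantCoeff_eq_zero _ _ (by simp),
    Finset.Nat.sum_antidiagonal_eq_sum_range_succ_mk]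
  refine Finset.sum_congr rfl fun i hi => ?_
  have hi' : i ≤ n := by rw [Finset.mem_range] at hi; omega
  have h : (1 - C q * X) * rescale (2 * (q - 1)) (mk 1 : R⟦X⟧) *
      (2 * X * (1 - C q * X) * rescale (2 * (q - 1)) (mk 1) ^ 2) ^ i =
      C (2 ^ i) * (X ^ i * ((1 - C q * X) ^ (i + 1) *
        rescale (2 * (q - 1)) (mk 1) ^ (2 * i + 1))) := by
    rw [map_pow, map_ofNat, mul_pow, mul_pow, mul_pow]
    ring
  rw [h, coeff_C_mul, coeff_X_pow_mul', if_pos hi', coeff_mul, Finset.mul_sum, Finset.mul_sum]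
  refine Finset.sum_congr rfl fun s _ => ?_
  rw [coeff_one_sub_C_mul_X_pow, coeff_rescale_mk_one_pow]
  simp [mul_assoc]

end BinaryTree

/-! ### The counting formulas -/

theorem card_isAlternating_eq_totalWeight (n : ℕ) :
    ((Nat.card {T : GNCTree n // T.IsAlternating} : ℕ) : ℤ) =
      BinaryTree.totalWeight (1 : ℤ) n := by
  rw [← BinaryTree.card_eq_totalWeight, ← GNCTree.card_isAlternating_ascents n fun _ => True]
  simp only [and_true]

theorem mainTheorem8 :
    (∀ n : ℕ, ((Nat.card {T : GNCTree n // T.IsAlternating} : ℕ) : ℤ) =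
      ∑ i ∈ Finset.range (n + 1),
        (-1) ^ (n - i) * ((i + 1).choose (n - i) : ℤ) * 2 ^ i * (catalan i : ℤ)) ∧
    (PowerSeries.mk fun n : ℕ => ((Nat.card {T : GNCTree n // T.IsAlternating} : ℕ) : ℤ)) =
      (1 - PowerSeries.X) *
        (PowerSeries.catalanSeries.map (Nat.castRingHom ℤ)).subst
          (2 * PowerSeries.X * (1 - PowerSeries.X) : PowerSeries ℤ) ∧
    (∀ n r : ℕ,
      ((Nat.card {T : GNCTree n // T.IsAlternating ∧ T.ascents.ncard = r} : ℕ) : ℤ) =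
        -- the sum over all `(i, j, k) = (p.1, q.1, q.2)` with `i + j + k = n`
        ∑ p ∈ Finset.HasAntidiagonal.antidiagonal n, ∑ q ∈ Finset.HasAntidiagonal.antidiagonal p.2,
          (-1) ^ (r + q.2) * ((p.1 + 1).choose q.1 : ℤ) * ((2 * p.1 + q.2).choose q.2 : ℤ) *
            (if q.1 ≤ r then (q.2.choose (r - q.1) : ℤ) else 0) *
            2 ^ (p.1 + q.2) * (catalan p.1 : ℤ)) := by
  refine ⟨fun n => ?_, ?_, fun n r => ?_⟩
  · rw [card_isAlternating_eq_totalWeight, BinaryTree.totalWeight_eq_sum,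
      Finset.Nat.sum_antidiagonal_eq_sum_range_succ_mk]
    refine Finset.sum_congr rfl fun i _ => ?_
    -- At `q = 1` the factor `(2 * (q - 1)) ^ k` kills every term with `k ≠ 0`.
    rw [Finset.sum_eq_single (n - i, 0)]
    · simp
      ring
    · rintro ⟨j, k⟩ hjk hne
      rw [Finset.HasAntidiagonal.mem_antidiagonal] at hjk
      have hk : k ≠ 0 := by
        rintro rfl
        exact hne (by simpa using hjk)
      simp [hk]
    · intro h
      exact absurd (Finset.HasAntidiagonal.mem_antidiagonal.2 (by simp)) h
  · simp only [card_isAlternating_eq_totalWeight]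
    have h := BinaryTree.mk_totalWeight_eq_closedForm (1 : ℤ)
    have h1 : PowerSeries.rescale (2 * ((1 : ℤ) - 1)) (PowerSeries.mk 1) = 1 := by
      simp
    rw [BinaryTree.closedForm, h1] at h
    simpa using h
  · have h := BinaryTree.card_eq_coeff_totalWeight (R := ℤ) n r
    rw [GNCTree.card_isAlternating_ascents n fun m => m = r, h, BinaryTree.totalWeight_eq_sum]
    simp only [Polynomial.finsetSum_coeff]
    refine Finset.sum_congr rfl fun p _ => Finset.sum_congr rfl fun s _ => ?_
    -- The variable marking ascents is isolated in `X ^ j * (X - 1) ^ k`, whose coefficients are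
    -- signed binomials.
    have hpoly : (catalan p.1 : Polynomial ℤ) * 2 ^ p.1 *
        ((-Polynomial.X) ^ s.1 * ((p.1 + 1).choose s.1 : Polynomial ℤ) *
          ((2 * (Polynomial.X - 1)) ^ s.2 * ((2 * p.1 + s.2).choose s.2 : Polynomial ℤ))) =
        Polynomial.C ((catalan p.1 : ℤ) * 2 ^ p.1 * (-1) ^ s.1 * ((p.1 + 1).choose s.1 : ℤ) *
          2 ^ s.2 * ((2 * p.1 + s.2).choose s.2 : ℤ)) *
          (Polynomial.X ^ s.1 * (Polynomial.X + Polynomial.C (-1)) ^ s.2) := by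
      simp only [map_mul, map_pow, map_natCast, map_neg, map_one, map_ofNat, neg_pow (Polynomial.X : Polynomial ℤ),
        mul_pow]
      ring
    rw [hpoly, Polynomial.coeff_C_mul, Polynomial.coeff_X_pow_mul']
    by_cases hsr : s.1 ≤ r
    · rw [if_pos hsr, if_pos hsr, Polynomial.coeff_X_add_C_pow]
      by_cases hc : r - s.1 ≤ s.2
      -- The exponents `j + (k - (r - j))` and `r + k` differ by the even number `2 (r - j)`.
      · have hsign : (-1 : ℤ) ^ s.1 * (-1) ^ (s.2 - (r - s.1)) = (-1) ^ (r + s.2) := by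
          rw [← pow_add]
          exact neg_one_pow_congr (by grind)
        rw [← hsign]
        ring
      · rw [Nat.choose_eq_zero_of_lt (show s.2 < r - s.1 by omega)]
        simp
    · rw [if_neg hsr, if_neg hsr]
      simp
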